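/- **Setting.** Consider the rank-$3$ tensor field theory with four-field interaction bubbles on fields numbered $1,2,3,4$: the tetrahedral bubble $b_+$, whose edges of colour $1$ are $12,34$, of colour $2$ are $13,24$ and of colour $3$ are $14,23$; and, for each colour $c\in\{1,2,3\}$, the melonic bubble $b_c$, whose edges of colour $c$ are $14,23$ and whose edges of each of the two other colours are $12,34$. An amputated Feynman graph $\mathcal G$ has a finite set of $V$ vertices, each carrying one of these bubbles and hence four half-lines; some of the half-lines are joined in pairs by propagator lines, and the $N_{\rm ext}$ remaining half-lines are the external legs. $\mathcal G$ is connected if it has at least one vertex and any two vertices are joined by a path of propagator lines. A face of colour $c$ is a maximal alternating sequence of propagator lines and bubble edges of colour $c$; it is internal if it is a cycle (contains no external leg), and $F_{\rm int}$ is the number of internal faces of all three colours. The divergence degree is $$\omega_{\deg}(\mathcal G)=-(V-1)+\tfrac12 F_{\rm int}.$$ The boundary graph $\partial\mathcal G$ has the external legs as vertices, with an edge of colour $c$ between the two ends of each open face of colour $c$. It is of melonic (resp. tetrahedral) type if it is isomorphic, as a coloured graph, to some $b_c$ (resp. to $b_+$). A bridge is a propagator line whose cutting disconnects the graph. Call $\mathcal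 G$ a *dressed tetrahedral vertex* if it has exactly one vertex of type $b_+$, and each of the four half-lines of that vertex is an external leg or belongs to a bridge. (For a connected $\mathcal G$ with $N_{\rm ext}=4$: $\mathcal G$ is the bare vertex $b_+$ or arises from it by attaching two-point graphs without $b_+$ vertices to its legs.) **Theorem.** Let $\mathcal G$ be a connected amputated Feynman graph. 1. If $N_{\rm ext}\ge 6$, then $\omega_{\deg}(\mathcal G)\le -N_{\rm ext}/12$; in particular $\omega_{\deg}(\mathcal G)<0$, i.e. $\mathcal G$ is convergent. 2. If $N_{\rm ext}=4$, then $\omega_{\deg}(\mathcal G)\le 0$. If equality holds and $\mathcal G$ is not a dressed tetrahedral vertex, then $\partial\mathcal G$ is of melonic type. If $\partial\mathcal G$ is of tetrahedral type and $\mathcal G$ is not a dressed tetrahedral vertex, then $\omega_{\deg}(\mathcal G)\le-\tfrac12$. If $\partial\mathcal G$ is disconnected, then $\omega_{\deg}(\mathcal G)\le-\tfrac12$. 3. If $N_{\rm ext}=2$, then $\omega_{\deg}(\mathcal G)\le 1$. -/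

import Mathlib

namespace TensorSYK

/-- The quartic interaction bubbles of the rank-3 model: the tetrahedral bubble `b_+`
and the melonic bubbles `b_c`, one for each colour `c`. -/
inductive Bubble : Type
  | tetra : Bubble
  | melonic (c : Fin 3) : Bubble

/-- The coloured edges of a bubble. The four fields are numbered in the order in which they are
written in the interaction; `b.edge c i` is the field joined to the field `i` by the edge of
colour `c`.
* `b_+` : colour 0 pairs 01, 23; colour 1 pairs 02, 13; colour 2 pairs 03, 12.
* `b_c` : colour `c` pairs 03, 12, and the two other colours pair 01, 23. -/
def Bubble.edge : Bubble → Fin 3 → Fin 4 → Fin 4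
  | .tetra, c => ![![1, 0, 3, 2], ![2, 3, 0, 1], ![3, 2, 1, 0]] c
  | .melonic c, c' => if c' = c then ![3, 2, 1, 0] else ![1, 0, 3, 2]

/-- An amputated Feynman graph with vertex set `V`. Every vertex carries a bubble and four
half-lines `(v, 0), …, (v, 3)`, one for each field of the bubble. The propagator lines (colour 0)
pair half-lines; a half-line that is not paired is fixed by `line` and is an external leg. -/
structure FeynmanGraph (V : Type*) where
  /-- the bubble at a vertex -/
  bubble : V → Bubble
  /-- the half-line at the other end of the propagator line, or the half-line itself if it is
  an external leg -/
  line : V × Fin 4 → V × Fin 4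
  line_line : ∀ h, line (line h) = h

namespace FeynmanGraph

variable {V : Type*} (G : FeynmanGraph V)

/-- The external legs. -/
abbrev ExternalLeg : Type _ := {h : V × Fin 4 // G.line h = h}

/-- The number of external legs. -/
noncomputable def numExt : ℕ := Nat.card G.ExternalLeg

/-- Two vertices are adjacent if a propagator line joins them. -/
def vertexGraph : SimpleGraph V where
  Adj v w := v ≠ w ∧ ∃ i j, G.line (v, i) = (w, j)
  symm := ⟨by
    rintro v w ⟨hne, i, j, hij⟩
    exact ⟨hne.symm, j, i, by rw [← hij, G.line_line]⟩⟩
  loopless := ⟨fun _ hv => hv.1 rfl⟩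

/-- A Feynman graph is connected if it has a vertex and any two vertices are joined by a path of
propagator lines. -/
def Connected : Prop := G.vertexGraph.Connected

/-- The half-line of the same vertex that is joined to `h` by the bubble edge of colour `c`. -/
def strand (c : Fin 3) (h : V × Fin 4) : V × Fin 4 := (h.1, (G.bubble h.1).edge c h.2)

/-- Two half-lines lie on the same face of colour `c` if one gets from one to the other along
propagator lines and bubble edges of colour `c`. -/
def sameFace (c : Fin 3) : Setoid (V × Fin 4) :=
  Relation.EqvGen.setoid fun h h' => h' = G.line h ∨ h' = G.strand c h

/-- The faces of colour `c`: the maximal alternating sequences of propagator lines and bubble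
edges of colour `c`. -/
abbrev Face (c : Fin 3) : Type _ := Quotient (G.sameFace c)

/-- A face is internal (closed) if it contains no external leg. -/
def IsInternalFace (c : Fin 3) (f : G.Face c) : Prop :=
  ∀ h : V × Fin 4, Quotient.mk (G.sameFace c) h = f → G.line h ≠ h

/-- The number of internal faces, of all three colours. -/
noncomputable def numInternalFaces : ℕ :=
  ∑ c : Fin 3, Set.ncard {f : G.Face c | G.IsInternalFace c f}

/-- The divergence degree `-(V - 1) + F_int / 2`. -/
noncomputable def divergenceDegree [Fintype V] : ℚ :=
  -((Fintype.card V : ℚ) - 1) + (G.numInternalFaces : ℚ) / 2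

/-- The edges of colour `c` of the boundary graph. Its vertices are the external legs, and two
distinct legs are joined by an edge of colour `c` if they are the two ends of an open face of
colour `c`. -/
def BoundaryAdj (c : Fin 3) (e e' : G.ExternalLeg) : Prop :=
  e ≠ e' ∧ (G.sameFace c).r e.1 e'.1

/-- The boundary graph with its colours forgotten. -/
def boundaryGraph : SimpleGraph G.ExternalLeg where
  Adj e e' := ∃ c, G.BoundaryAdj c e e'
  symm := ⟨fun _ _ ⟨c, hne, hc⟩ => ⟨c, hne.symm, (G.sameFace c).iseqv.symm hc⟩⟩
  loopless := ⟨fun _ ⟨_, hne, _⟩ => hne rfl⟩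

/-- The boundary graph is isomorphic, as a coloured graph, to the bubble `b`. -/
def BoundaryIs (b : Bubble) : Prop :=
  ∃ φ : G.ExternalLeg ≃ Fin 4, ∀ c e e', G.BoundaryAdj c e e' ↔ b.edge c (φ e) = φ e'

open Classical in
/-- The graph obtained by cutting the propagator line at `h` into two external legs. -/
noncomputable def cut (h : V × Fin 4) : FeynmanGraph V where
  bubble := G.bubble
  line x := if x = h ∨ x = G.line h then x else G.line x
  line_line x := by
    have h1 := G.line_line x
    have h2 := G.line_line h
    by_cases hx : x = h ∨ x = G.line h
    · simp [hx]
    · have hy : ¬ (G.line x = h ∨ G.line x = G.line h) := by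
        rintro (h3 | h3)
        · exact hx (Or.inr (by rw [← h1, h3]))
        · exact hx (Or.inl (by rw [← h1, h3, h2]))
      simp [hx, hy, h1]

/-- The half-line `h` belongs to a bridge: a propagator line whose cutting disconnects the
graph. -/
def IsBridge (h : V × Fin 4) : Prop := G.line h ≠ h ∧ ¬ (G.cut h).Connected

/-- A dressed tetrahedral vertex: a graph with exactly one tetrahedral vertex, all of whose
half-lines are external legs or belong to bridges. For a connected graph with four external legs
this says that it is a bare vertex `b_+`, or arises from it by inserting two-point graphs on
external legs. -/
def IsDressedTetra : Prop :=
  ∃ v, G.bubble v = .tetra ∧ (∀ w, G.bubble w = .tetra → w = v) ∧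
    ∀ i, G.line (v, i) = (v, i) ∨ G.IsBridge (v, i)

end FeynmanGraph

end TensorSYK

/-! Fix a colour `c`. The lines and the strands of the two other colours form a ribbon graph. Each
vertex contributes to it one bubble cycle, or two if the vertex is melonic of colour `c`. Over `ZMod
2`, faces, bubble cycles and components become spaces of invariant functions. Euler's inequality is
then a dimension count for two orthogonal subspaces (`euler_inequality`). Let `m_c` be the number of
melonic vertices of colour `c`, `T` the number of tetrahedral ones, `F` the number of internal faces
and `N` the number of legs. Since the graph is connected, the ribbon graph has at most `m_c + 1`
components (`finrank_ribbonSpace_le`). Summing Euler's inequality over `c` gives `4F + 3N + 2T ≤ 8V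
+ 6` for `N > 0` (`face_bound`), hence the general bounds for `N ≥ 6`, `N = 4` and `N = 2`.

For `N = 4` the open faces give three perfect matchings of the legs. If these coincide, gluing the
legs along them closes the ribbon graphs and improves the bound (`face_bound_of_partner_eq`).
Otherwise the boundary is a bubble, in particular connected. There remains a tetrahedral boundary
with degree above `-1/2`. The count then forces `T ≤ 1` and `m_c + 1` components for every `c`. So
splitting any melonic vertex into its two halves disconnects the graph, and all legs stay on one
side because any two boundary colours connect them. Such splittings turn a function constant along
chains through melonic vertices into one constant at those vertices (`exists_straighten`). By
connectedness, the chain from each leg must reach the tetrahedral vertex, and any propagator line by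
which it arrives there is a bridge. -/

namespace TensorSYK

open Module

/-! ### Paths traced by two involutions -/

section Involutions

variable {X : Type*}

/-- The relation generated by two maps. -/
abbrev Joined (x y : X → X) : X → X → Prop :=
  Relation.EqvGen fun h h' => h' = x h ∨ h' = y h

theorem Joined.swap {x y : X → X} {h h' : X} (hj : Joined x y h h') : Joined y x h h' :=
  Relation.EqvGen.mono (p := fun h h' => h' = y h ∨ h' = x h) (fun _ _ => Or.symm) _ _ hj

theorem joined_left (x y : X → X) (h : X) : Joined x y h (x h) :=
  Relation.EqvGen.rel _ _ (Or.inl rfl)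

theorem joined_right (x y : X → X) (h : X) : Joined x y h (y h) :=
  Relation.EqvGen.rel _ _ (Or.inr rfl)

theorem Joined.trans {x y : X → X} {h h' h'' : X} (h1 : Joined x y h h')
    (h2 : Joined x y h' h'') : Joined x y h h'' :=
  Relation.EqvGen.trans _ _ _ h1 h2

theorem Joined.symm {x y : X → X} {h h' : X} (h1 : Joined x y h h') : Joined x y h' h :=
  Relation.EqvGen.symm _ _ h1

theorem Joined.apply_eq {x y : X → X} {β : Type*} {f : X → β} (hx : ∀ h, f (x h) = f h)
    (hy : ∀ h, f (y h) = f h) {h h' : X} (hj : Joined x y h h') : f h = f h' := by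
  induction hj with
  | rel a b hab => rcases hab with rfl | rfl <;> simp [hx, hy]
  | refl => rfl
  | symm _ _ _ ih => exact ih.symm
  | trans _ _ _ _ _ ih1 ih2 => exact ih1.trans ih2

theorem perm_zpow_swap (x y : Equiv.Perm X) (hx : x * x = 1) (hy : y * y = 1) (k : ℤ) :
    x * (x * y) ^ k = (x * y) ^ (-k) * x := by
  have hxi : x⁻¹ = x := inv_eq_of_mul_eq_one_left hx
  have hyi : y⁻¹ = y := inv_eq_of_mul_eq_one_left hy
  have h : x * (x * y) * x⁻¹ = (x * y)⁻¹ := by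
    rw [mul_inv_rev, hxi, hyi, ← mul_assoc, hx, one_mul]
  calc x * (x * y) ^ k = (x * (x * y) * x⁻¹) ^ k * x := by rw [conj_zpow]; group
    _ = _ := by rw [h, inv_zpow']

section Path

variable {x y : X → X}

/-- The composition of two involutions. -/
def rot (hx : Function.Involutive x) (hy : Function.Involutive y)
    : Equiv.Perm X := hx.toPerm * hy.toPerm

theorem left_rot_zpow (hx : Function.Involutive x) (hy : Function.Involutive y)
    (k : ℤ) (h : X) : x ((rot hx hy ^ k) h) = (rot hx hy ^ (-k)) (x h) := by
  have := perm_zpow_swap hx.toPerm hy.toPerm (by ext; simp [hx _]) (by ext; simp [hy _]) k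
  exact congrArg (fun p : Equiv.Perm X => p h) this

theorem right_rot_zpow (hx : Function.Involutive x) (hy : Function.Involutive y)
    (k : ℤ) (h : X) :
    y ((rot hx hy ^ k) h) = (rot hx hy ^ (-k - 1)) (x h) := by
  have h1 : ∀ z, y z = x (rot hx hy z) := fun z => by simp [rot, hx _]
  rw [h1, ← Equiv.Perm.mul_apply, ← zpow_one_add, left_rot_zpow hx hy]
  congr 2; ring

/-- Both involutions reverse the rotation, so the rotation orbit of a point fixed by `x` is already
stable under them. Positions on the path are thus measured by integers modulo the period. -/
theorem Joined.exists_rot_zpow (hx : Function.Involutive x) (hy : Function.Involutive y)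
    {e : X} (he : x e = e) {h : X} (hj : Joined x y e h) :
    ∃ k : ℤ, h = (rot hx hy ^ k) e := by
  have key : ∀ a b, Joined x y a b →
      ((∃ k : ℤ, a = (rot hx hy ^ k) e) ↔ ∃ k : ℤ, b = (rot hx hy ^ k) e) := by
    intro a b hab
    refine (Joined.apply_eq (f := fun a => ∃ k : ℤ, a = (rot hx hy ^ k) e) ?_ ?_ hab).to_iff
    · have : ∀ a, (∃ k : ℤ, a = (rot hx hy ^ k) e) → ∃ k : ℤ, x a = (rot hx hy ^ k) e := by
        rintro a ⟨k, rfl⟩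
        exact ⟨-k, by rw [left_rot_zpow hx hy, he]⟩
      exact fun a => propext ⟨fun h => hx a ▸ this _ h, this a⟩
    · have : ∀ a, (∃ k : ℤ, a = (rot hx hy ^ k) e) → ∃ k : ℤ, y a = (rot hx hy ^ k) e := by
        rintro a ⟨k, rfl⟩
        exact ⟨-k - 1, by rw [right_rot_zpow hx hy, he]⟩
      exact fun a => propext ⟨fun h => hy a ▸ this _ h, this a⟩
  exact (key e h hj).1 ⟨0, by simp⟩

theorem joined_rot_zpow (hx : Function.Involutive x) (hy : Function.Involutive y)
    (k : ℤ) (e : X) : Joined x y e ((rot hx hy ^ k) e) := by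
  have step : ∀ a, Joined x y a (rot hx hy a) := fun a =>
    (joined_right x y a).trans (joined_left x y (y a))
  induction k with
  | zero => exact Relation.EqvGen.refl _
  | succ n ih =>
    rw [add_comm, zpow_one_add, Equiv.Perm.mul_apply]
    exact Joined.trans ih (step _)
  | pred n ih =>
    refine Joined.trans ih (Joined.symm ?_)
    have := step ((rot hx hy ^ (-(n : ℤ) - 1)) e)
    rwa [← Equiv.Perm.mul_apply, ← zpow_one_add, add_sub_cancel] at this

theorem left_fixed_iff (hx : Function.Involutive x) (hy : Function.Involutive y)
    {e : X} (he : x e = e) (k : ℤ) :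
    x ((rot hx hy ^ k) e) = (rot hx hy ^ k) e ↔
      (Function.minimalPeriod (rot hx hy • ·) e : ℤ) ∣ 2 * k := by
  rw [← MulAction.zpow_smul_eq_iff_minimalPeriod_dvd, left_rot_zpow hx hy, he, zpow_neg,
    Equiv.Perm.inv_eq_iff_eq, ← Equiv.Perm.mul_apply, ← zpow_add, ← two_mul, eq_comm]
  rfl

theorem right_fixed_iff (hx : Function.Involutive x) (hy : Function.Involutive y)
    {e : X} (he : x e = e) (k : ℤ) :
    y ((rot hx hy ^ k) e) = (rot hx hy ^ k) e ↔
      (Function.minimalPeriod (rot hx hy • ·) e : ℤ) ∣ 2 * k + 1 := by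
  rw [← MulAction.zpow_smul_eq_iff_minimalPeriod_dvd, right_rot_zpow hx hy, he,
    show -k - 1 = -(k + 1) by ring, zpow_neg,
    Equiv.Perm.inv_eq_iff_eq, ← Equiv.Perm.mul_apply, ← zpow_add,
    show k + 1 + k = 2 * k + 1 by ring, eq_comm]
  rfl

/-- A path with a free end of each kind has no further free end. -/
theorem eq_of_joined_of_fixed (hx : Function.Involutive x) (hy : Function.Involutive y)
    {e e' d : X} (he : x e = e) (he' : x e' = e') (hd : y d = d)
    (h1 : Joined x y e e') (h2 : Joined x y e d) : e' = e := by
  obtain ⟨j, rfl⟩ := Joined.exists_rot_zpow hx hy he h1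
  obtain ⟨k, rfl⟩ := Joined.exists_rot_zpow hx hy he h2
  rw [left_fixed_iff hx hy he] at he'
  rw [right_fixed_iff hx hy he] at hd
  -- The period divides `2j` and is odd, as it divides `2k + 1`; hence it divides `j`.
  have := dvd_sub (hd.mul_right j) (he'.mul_right k)
  rw [show (2 * k + 1) * j - 2 * j * k = j by ring] at this
  exact (MulAction.zpow_smul_eq_iff_minimalPeriod_dvd ..).2 this

/-- A path has at most two free ends. -/
theorem eq_or_eq_of_joined (hx : Function.Involutive x) (hy : Function.Involutive y)
    {e e' e'' : X} (he : x e = e) (he' : x e' = e') (he'' : x e'' = e'')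
    (h1 : Joined x y e e') (h2 : Joined x y e e'') : e' = e ∨ e'' = e ∨ e' = e'' := by
  obtain ⟨j, rfl⟩ := Joined.exists_rot_zpow hx hy he h1
  obtain ⟨l, rfl⟩ := Joined.exists_rot_zpow hx hy he h2
  rw [left_fixed_iff hx hy he] at he' he''
  obtain ⟨n, hn⟩ : ∃ n : ℤ, n = (Function.minimalPeriod (rot hx hy • ·) e : ℕ) := ⟨_, rfl⟩
  have fix : ∀ k : ℤ, (rot hx hy ^ k) e = e ↔ n ∣ k := fun k =>
    hn ▸ MulAction.zpow_smul_eq_iff_minimalPeriod_dvd (a := rot hx hy) (b := e) (n := k)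
  rw [fix, fix]
  rw [← hn] at he' he''
  obtain ⟨q, hq⟩ := he'
  obtain ⟨r, hr⟩ := he''
  rcases Int.even_or_odd' q with ⟨q', rfl | rfl⟩
  · exact Or.inl ⟨q', by linarith⟩
  rcases Int.even_or_odd' r with ⟨r', rfl | rfl⟩
  · exact Or.inr (Or.inl ⟨r', by linarith⟩)
  refine Or.inr (Or.inr ?_)
  have : (rot hx hy ^ (j - l)) e = e := (fix _).2 ⟨q' - r', by linarith⟩
  rw [show j = l + (j - l) by ring, zpow_add, Equiv.Perm.mul_apply, this]

/-- A path that starts at a free end has a second one. -/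
theorem exists_joined_ne (hx : Function.Involutive x) (hy : Function.Involutive y)
    [Finite X] {e : X} (he : x e = e) (hfree : ∀ h, y h ≠ h) :
    ∃ e', e' ≠ e ∧ x e' = e' ∧ Joined x y e e' := by
  have hpos : 0 < Function.minimalPeriod (rot hx hy • ·) e :=
    Function.minimalPeriod_pos_of_mem_periodicPts
      ((rot hx hy).injective.mem_periodicPts e)
  rcases Nat.even_or_odd' (Function.minimalPeriod (rot hx hy • ·) e) with ⟨k, hk | hk⟩
  · refine ⟨(rot hx hy ^ (k : ℤ)) e, fun h => ?_, ?_, joined_rot_zpow hx hy _ _⟩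
    · have := (MulAction.zpow_smul_eq_iff_minimalPeriod_dvd (a := rot hx hy) (b := e)
        (n := k)).1 h
      rw [hk, Int.natCast_dvd_natCast] at this
      have := Nat.le_of_dvd (by omega) this
      omega
    · rw [left_fixed_iff hx hy he, hk]
      push_cast; exact dvd_rfl
  · refine absurd ((right_fixed_iff hx hy he k).2 ?_) (hfree _)
    rw [hk]; push_cast; exact dvd_rfl

end Path

end Involutions

/-! ### Euler's inequality over the field with two elements -/

section LinearAlgebra

variable {X : Type*}

/-- The functions that are invariant under a map. -/
def invariants (s : X → X) : Submodule (ZMod 2) (X → ZMod 2) where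
  carrier := {f | ∀ h, f (s h) = f h}
  add_mem' hf hg h := by simp [hf h, hg h]
  zero_mem' _ := rfl
  smul_mem' a f hf h := by simp [hf h]

@[simp] theorem mem_invariants {s : X → X} {f : X → ZMod 2} :
    f ∈ invariants s ↔ ∀ h, f (s h) = f h := Iff.rfl

variable [Fintype X]

/-- If `s` is an involution, only its fixed points contribute to the sum of an invariant
function modulo two. -/
theorem sum_eq_zero_of_invariant {s : X → X} (hs : Function.Involutive s) {f : X → ZMod 2}
    (hf : ∀ h, f (s h) = f h) (h0 : ∀ h, s h = h → f h = 0) : ∑ h, f h = 0 :=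
  Finset.sum_involution (fun h _ => s h) (fun h _ => by rw [hf]; exact CharTwo.add_self_eq_zero _)
    (fun h _ hne heq => hne (h0 h heq)) (fun _ _ => Finset.mem_univ _) (fun h _ => hs h)

/-- In characteristic two, `1 + s` has both its kernel and its range among the invariants;
rank-nullity concludes. -/
theorem card_le_two_mul_finrank_invariants {s : X → X} (hs : Function.Involutive s) :
    Fintype.card X ≤ 2 * finrank (ZMod 2) (invariants s) := by
  let φ : (X → ZMod 2) →ₗ[ZMod 2] (X → ZMod 2) := LinearMap.id + LinearMap.funLeft _ _ s
  have hφ : ∀ f h, φ f h = f h + f (s h) := fun f h => rfl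
  have h1 : LinearMap.ker φ ≤ invariants s := fun f hf h => by
    have := congrFun (LinearMap.mem_ker.1 hf) h
    rw [hφ] at this
    exact (CharTwo.add_eq_zero.1 this).symm
  have h2 : LinearMap.range φ ≤ invariants s := by
    rintro _ ⟨f, rfl⟩ h
    rw [hφ, hφ, hs h, add_comm]
  have := φ.finrank_range_add_finrank_ker
  rw [finrank_fintype_fun_eq_card] at this
  have := Submodule.finrank_mono h1
  have := Submodule.finrank_mono h2
  omega

theorem finrank_add_finrank_le_of_dotProduct {U W : Submodule (ZMod 2) (X → ZMod 2)}
    (h : ∀ f ∈ U, ∀ g ∈ W, f ⬝ᵥ g = 0) :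
    finrank (ZMod 2) U + finrank (ZMod 2) W ≤ Fintype.card X := by
  classical
  let e := dotProductEquiv (ZMod 2) X
  have h1 : W.map e.toLinearMap ≤ U.dualAnnihilator := by
    rintro _ ⟨g, hg, rfl⟩
    rw [Submodule.mem_dualAnnihilator]
    intro f hf
    rw [← h f hf g hg, dotProduct_comm]
    rfl
  have h2 := Submodule.finrank_mono h1
  rw [LinearEquiv.finrank_map_eq e W] at h2
  have h3 := Subspace.finrank_add_finrank_dualAnnihilator_eq U
  rw [finrank_fintype_fun_eq_card] at h3
  omega

/-- The Euler inequality of a closed combinatorial map, in terms of invariant functions. -/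
theorem euler_inequality {s : X → X} (hs : Function.Involutive s) (hfree : ∀ h, s h ≠ h)
    {P Q R : Submodule (ZMod 2) (X → ZMod 2)} (hP : P ≤ invariants s) (hQ : Q ≤ invariants s)
    (hPR : ∀ f ∈ P, ∀ g ∈ R, f ⬝ᵥ g = 0) (hQR : ∀ f ∈ Q, ∀ g ∈ R, f ⬝ᵥ g = 0) :
    2 * (finrank (ZMod 2) P + finrank (ZMod 2) Q + finrank (ZMod 2) R) ≤
      Fintype.card X + 2 * finrank (ZMod 2) (P ⊓ Q : Submodule (ZMod 2) (X → ZMod 2)) +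
        2 * finrank (ZMod 2) (R ⊓ invariants s : Submodule (ZMod 2) (X → ZMod 2)) := by
  -- Orthogonality to `invariants s` holds because values of an invariant product cancel in pairs
  -- under the free involution `s`.
  have h1 : finrank (ZMod 2) (P ⊔ Q : Submodule (ZMod 2) (X → ZMod 2)) +
      finrank (ZMod 2) (R ⊔ invariants s : Submodule (ZMod 2) (X → ZMod 2)) ≤
        Fintype.card X := by
    have hs0 : ∀ f ∈ invariants s, ∀ g ∈ invariants s, f ⬝ᵥ g = 0 := fun f hf g hg =>
      sum_eq_zero_of_invariant hs (fun h => by rw [hf h, hg h]) fun h hh => absurd hh (hfree h)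
    apply finrank_add_finrank_le_of_dotProduct
    intro f hf g hg
    obtain ⟨p, hp, q, hq, rfl⟩ := Submodule.mem_sup.1 hf
    obtain ⟨r, hr, i, hi, rfl⟩ := Submodule.mem_sup.1 hg
    rw [add_dotProduct, dotProduct_add, dotProduct_add, hPR p hp r hr, hQR q hq r hr,
      hs0 p (hP hp) i hi, hs0 q (hQ hq) i hi]
    simp
  have h2 := Submodule.finrank_sup_add_finrank_inf_eq P Q
  have h3 := Submodule.finrank_sup_add_finrank_inf_eq R (invariants s)
  have h4 := card_le_two_mul_finrank_invariants hs
  omega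

theorem card_le_finrank_of_injective {ι : Type*} [Fintype ι]
    {W : Submodule (ZMod 2) (X → ZMod 2)} (L : (ι → ZMod 2) →ₗ[ZMod 2] (X → ZMod 2))
    (hL : Function.Injective L) (hW : ∀ f, L f ∈ W) : Fintype.card ι ≤ finrank (ZMod 2) W := by
  have := LinearMap.finrank_le_finrank_of_injective (f := L.codRestrict W hW)
    (fun a b hab => hL (congrArg Subtype.val hab))
  rwa [finrank_fintype_fun_eq_card] at this

end LinearAlgebra

/-! ### Combinatorics of the bubbles -/

theorem Bubble.edge_edge (b : Bubble) (c : Fin 3) (i : Fin 4) : b.edge c (b.edge c i) = i := by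
  rcases b with _ | d
  · revert c i; decide
  · revert c i d; decide

theorem Bubble.edge_ne (b : Bubble) (c : Fin 3) (i : Fin 4) : b.edge c i ≠ i := by
  rcases b with _ | d
  · revert c i; decide
  · revert c i d; decide

theorem Bubble.melonic_edge_eq_iff {c d : Fin 3} (hd : d ≠ c) {i : Fin 4} :
    (Bubble.melonic c).edge d i = 2 ∨ (Bubble.melonic c).edge d i = 3 ↔ i = 2 ∨ i = 3 := by
  revert c d i; decide

/-- The edges of two colours connect all fields of a bubble, unless it is melonic of the third
colour. -/
theorem Bubble.eq_edge_or (b : Bubble) (c : Fin 3) (i : Fin 4) :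
    i = 0 ∨ b.edge (c + 1) 0 = i ∨ b.edge (c + 2) 0 = i ∨
      b.edge (c + 1) (b.edge (c + 2) 0) = i ∨
      (b = .melonic c ∧ (i = 2 ∨ b.edge (c + 1) 2 = i)) := by
  have h1 : ∀ (c : Fin 3) (i : Fin 4), i = 0 ∨ Bubble.tetra.edge (c + 1) 0 = i ∨
      Bubble.tetra.edge (c + 2) 0 = i ∨
      Bubble.tetra.edge (c + 1) (Bubble.tetra.edge (c + 2) 0) = i := by decide
  have h2 : ∀ d c : Fin 3, d ≠ c → ∀ i, i = 0 ∨ (Bubble.melonic d).edge (c + 1) 0 = i ∨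
      (Bubble.melonic d).edge (c + 2) 0 = i ∨
      (Bubble.melonic d).edge (c + 1) ((Bubble.melonic d).edge (c + 2) 0) = i := by decide
  have h3 : ∀ (c : Fin 3) (i : Fin 4), i = 0 ∨ (Bubble.melonic c).edge (c + 1) 0 = i ∨ i = 2 ∨
      (Bubble.melonic c).edge (c + 1) 2 = i := by decide
  rcases b with _ | d
  · rcases h1 c i with h | h | h | h <;> simp [h]
  · by_cases hd : d = c
    · subst hd
      rcases h3 d i with h | h | h | h <;> simp [h]
    · rcases h2 d c hd i with h | h | h | h <;> simp [h]

namespace FeynmanGraph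

variable {V : Type*} (G : FeynmanGraph V)

theorem line_involutive : Function.Involutive G.line := G.line_line

theorem strand_involutive (c : Fin 3) : Function.Involutive (G.strand c) := fun h => by
  simp [strand, Bubble.edge_edge]

theorem strand_ne (c : Fin 3) (h : V × Fin 4) : G.strand c h ≠ h := fun hh =>
  Bubble.edge_ne _ _ _ (congrArg Prod.snd hh)

/-- A function on the half-lines that is constant on lines and on vertices is constant. -/
theorem Connected.eq_of_invariant (hG : G.Connected) {α : Type*} {f : V × Fin 4 → α}
    (hl : ∀ h, f (G.line h) = f h) (hv : ∀ v i, f (v, i) = f (v, 0)) (h h' : V × Fin 4) :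
    f h = f h' := by
  have key : ∀ v w, G.vertexGraph.Adj v w → f (v, 0) = f (w, 0) := by
    rintro v w ⟨-, i, j, hij⟩
    rw [← hv v i, ← hl, hij, hv]
  have : f (h.1, 0) = f (h'.1, 0) := by
    generalize h.1 = v, h'.1 = w
    obtain ⟨p⟩ := SimpleGraph.Connected.preconnected hG v w
    induction p with
    | nil => rfl
    | cons hadj _ ih => exact (key _ _ hadj).trans ih
  rw [← hv h.1 h.2, ← hv h'.1 h'.2] at this
  exact this

/-! ### Legs and faces -/

theorem exists_boundaryAdj [Finite V] (c : Fin 3) (e : G.ExternalLeg) :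
    ∃ e', G.BoundaryAdj c e e' := by
  obtain ⟨e', hne, he', hj⟩ := exists_joined_ne G.line_involutive (G.strand_involutive c) e.2
    (G.strand_ne c)
  exact ⟨⟨e', he'⟩, fun h => hne (congrArg Subtype.val h).symm, hj⟩

theorem eq_of_boundaryAdj {c : Fin 3} {e e' e'' : G.ExternalLeg} (h1 : G.BoundaryAdj c e e')
    (h2 : G.BoundaryAdj c e e'') : e' = e'' := by
  rcases eq_or_eq_of_joined G.line_involutive (G.strand_involutive c) e.2 e'.2 e''.2 h1.2 h2.2
    with h | h | h
  · exact absurd (Subtype.ext h).symm h1.1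
  · exact absurd (Subtype.ext h).symm h2.1
  · exact Subtype.ext h

/-- The other end of the open face of colour `c` that starts at an external leg. -/
noncomputable def partner [Finite V] (c : Fin 3) (e : G.ExternalLeg) : G.ExternalLeg :=
  (G.exists_boundaryAdj c e).choose

section Finite

variable [Finite V]

theorem boundaryAdj_partner (c : Fin 3) (e : G.ExternalLeg) :
    G.BoundaryAdj c e (G.partner c e) := (G.exists_boundaryAdj c e).choose_spec

theorem boundaryAdj_iff {c : Fin 3} {e e' : G.ExternalLeg} :
    G.BoundaryAdj c e e' ↔ G.partner c e = e' :=
  ⟨G.eq_of_boundaryAdj (G.boundaryAdj_partner c e), fun h => h ▸ G.boundaryAdj_partner c e⟩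

theorem partner_ne (c : Fin 3) (e : G.ExternalLeg) : G.partner c e ≠ e := fun h =>
  (G.boundaryAdj_partner c e).1 h.symm

theorem partner_involutive (c : Fin 3) : Function.Involutive (G.partner c) := fun e =>
  G.boundaryAdj_iff.1 ⟨G.partner_ne c e, Joined.symm (G.boundaryAdj_partner c e).2⟩

/-- A function that is constant on the faces of colour `c` agrees at the two ends of an open
face. -/
theorem apply_partner {c : Fin 3} {α : Type*} {f : V × Fin 4 → α}
    (hl : ∀ h, f (G.line h) = f h) (hs : ∀ h, f (G.strand c h) = f h) (e : G.ExternalLeg) :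
    f (G.partner c e).1 = f e.1 :=
  (Joined.apply_eq hl hs (G.boundaryAdj_partner c e).2).symm

/-- The number of internal faces of colour `c`. -/
noncomputable def numInternal (c : Fin 3) : ℕ := Set.ncard {f : G.Face c | G.IsInternalFace c f}

/-- Every leg lies on a non-internal face, and such a face contains at most two legs. -/
theorem numExt_le (c : Fin 3) :
    G.numExt + 2 * G.numInternal c ≤ 2 * Nat.card (G.Face c) := by
  classical
  have := Fintype.ofFinite V
  have := Fintype.ofFinite (G.Face c)
  let S : Finset (G.Face c) := Finset.univ.filter fun f => ¬ G.IsInternalFace c f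
  have h1 : Fintype.card G.ExternalLeg ≤ 2 * S.card := by
    rw [← Finset.card_univ]
    refine Finset.card_le_mul_card_image_of_maps_to
      (f := fun e : G.ExternalLeg => (Quotient.mk (G.sameFace c) e.1 : G.Face c)) ?_ 2 ?_
    · intro e _
      exact Finset.mem_filter.2 ⟨Finset.mem_univ _, fun h => h e.1 rfl e.2⟩
    · intro f _
      by_contra! hlt
      obtain ⟨a, b, d, ha, hb, hd, hab, had, hbd⟩ := Finset.two_lt_card_iff.1 hlt
      simp only [Finset.mem_filter, Finset.mem_univ, true_and] at ha hb hd
      exact hbd (G.eq_of_boundaryAdj ⟨hab, Quotient.exact (ha.trans hb.symm)⟩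
        ⟨had, Quotient.exact (ha.trans hd.symm)⟩)
  have h2 := Finset.card_filter_add_card_filter_not (s := (Finset.univ : Finset (G.Face c)))
    (fun f => G.IsInternalFace c f)
  have h3 : G.numInternal c = (Finset.univ.filter fun f => G.IsInternalFace c f).card := by
    rw [numInternal, Set.ncard_eq_toFinset_card']
    congr 1
    ext f
    simp
  rw [Finset.card_univ] at h2
  rw [numExt, Nat.card_eq_fintype_card, Nat.card_eq_fintype_card, h3]
  change _ + S.card = _ at h2
  omega

end Finite

/-! ### Spaces of invariant functions -/

/-- The functions that are constant on the faces of colour `c`. -/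
def faceSpace (c : Fin 3) : Submodule (ZMod 2) (V × Fin 4 → ZMod 2) :=
  invariants G.line ⊓ invariants (G.strand c)

/-- The functions that vanish on the external legs. -/
def legVanishing : Submodule (ZMod 2) (V × Fin 4 → ZMod 2) where
  carrier := {f | ∀ h, G.line h = h → f h = 0}
  add_mem' hf hg h hh := by simp [hf h hh, hg h hh]
  zero_mem' _ _ := rfl
  smul_mem' a f hf h hh := by simp [hf h hh]

/-- The functions that are constant on the cycles of colours other than `c` in the bubbles. -/
def bubbleSpace (c : Fin 3) : Submodule (ZMod 2) (V × Fin 4 → ZMod 2) :=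
  invariants (G.strand (c + 1)) ⊓ invariants (G.strand (c + 2))

/-- The functions that are constant on the connected components of the ribbon graph of the colours
other than `c`. -/
def ribbonSpace (c : Fin 3) : Submodule (ZMod 2) (V × Fin 4 → ZMod 2) :=
  G.bubbleSpace c ⊓ invariants G.line

theorem vertexConst_of_mem_bubbleSpace {c : Fin 3} {f : V × Fin 4 → ZMod 2}
    (hf : f ∈ G.bubbleSpace c) (v : V) (hv : G.bubble v = .melonic c → f (v, 0) = f (v, 2))
    (i : Fin 4) : f (v, i) = f (v, 0) := by
  have h1 := fun j => hf.1 (v, j)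
  have h2 := fun j => hf.2 (v, j)
  simp only [strand] at h1 h2
  generalize G.bubble v = b at *
  have key := Bubble.eq_edge_or b c i
  rcases key with rfl | rfl | rfl | rfl | ⟨hb, rfl | rfl⟩
  · rfl
  · rw [h1]
  · rw [h2]
  · rw [h1, h2]
  · exact (hv hb).symm
  · rw [h1]; exact (hv hb).symm

/-- Ribbon graph components are separated by splitting the melonic vertices of colour `c`. -/
def splitMap (c : Fin 3) :
    G.ribbonSpace c →ₗ[ZMod 2] ({v // G.bubble v = .melonic c} → ZMod 2) where
  toFun f v := f.1 (v.1, 0) + f.1 (v.1, 2)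
  map_add' f g := by ext v; simp; ring
  map_smul' a f := by ext v; simp; ring

/-- Without jumps at the melonic vertices of colour `c`, the function is constant at every vertex,
so connectedness leaves only the constants. -/
theorem finrank_ker_splitMap_le (hG : G.Connected) (c : Fin 3) :
    finrank (ZMod 2) (LinearMap.ker (G.splitMap c)) ≤ 1 := by
  have hone : (fun _ => 1 : V × Fin 4 → ZMod 2) ∈ G.ribbonSpace c :=
    ⟨⟨fun _ => rfl, fun _ => rfl⟩, fun _ => rfl⟩
  refine (Submodule.finrank_mono (t := Submodule.span (ZMod 2) {⟨_, hone⟩}) ?_).trans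
    ((finrank_span_le_card _).trans (by simp))
  rintro ⟨f, hf⟩ hk
  rw [Submodule.mem_span_singleton]
  have hc := hG.eq_of_invariant (f := f) G hf.2 fun v i =>
    G.vertexConst_of_mem_bubbleSpace hf.1 v (fun hv => by
      have := congrFun (LinearMap.mem_ker.1 hk) ⟨v, hv⟩
      exact CharTwo.add_eq_zero.1 this) i
  obtain ⟨v⟩ := SimpleGraph.Connected.nonempty hG
  refine ⟨f (v, 0), Subtype.ext (funext fun h => ?_)⟩
  simpa using hc (v, 0) h

section Fintype

variable [Fintype V]

theorem card_face_le (c : Fin 3) : Nat.card (G.Face c) ≤ finrank (ZMod 2) (G.faceSpace c) := by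
  have := Fintype.ofFinite (G.Face c)
  rw [Nat.card_eq_fintype_card]
  refine card_le_finrank_of_injective
    (LinearMap.funLeft (ZMod 2) (ZMod 2) (Quotient.mk (G.sameFace c)))
    (LinearMap.funLeft_injective_of_surjective _ _ _ Quotient.mk_surjective) fun f => ⟨?_, ?_⟩
  · intro h
    exact congrArg f (Quotient.sound (Joined.symm (joined_left G.line (G.strand c) h)))
  · intro h
    exact congrArg f (Quotient.sound (Joined.symm (joined_right G.line (G.strand c) h)))

theorem numInternal_le (c : Fin 3) :
    G.numInternal c ≤
      finrank (ZMod 2) (G.faceSpace c ⊓ G.legVanishing : Submodule (ZMod 2) (V × Fin 4 → ZMod 2)) := by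
  classical
  have := Fintype.ofFinite {f : G.Face c | G.IsInternalFace c f}
  rw [numInternal, ← Nat.card_coe_set_eq, Nat.card_eq_fintype_card]
  let L : ({f : G.Face c | G.IsInternalFace c f} → ZMod 2) →ₗ[ZMod 2] (V × Fin 4 → ZMod 2) :=
    { toFun := fun f h => if hh : G.IsInternalFace c (Quotient.mk (G.sameFace c) h)
        then f ⟨Quotient.mk (G.sameFace c) h, hh⟩ else 0
      map_add' := fun f g => by ext h; by_cases hh : G.IsInternalFace c (Quotient.mk _ h) <;> simp [hh]
      map_smul' := fun a f => by ext h; by_cases hh : G.IsInternalFace c (Quotient.mk _ h) <;> simp [hh] }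
  have hL : ∀ f h, L f h = if hh : G.IsInternalFace c (Quotient.mk (G.sameFace c) h)
        then f ⟨Quotient.mk (G.sameFace c) h, hh⟩ else 0 := fun f h => rfl
  have hcongr : ∀ f h h', (Quotient.mk (G.sameFace c) h = Quotient.mk (G.sameFace c) h') →
      L f h = L f h' := fun f h h' heq => by rw [hL, hL]; simp only [heq]
  refine card_le_finrank_of_injective L ?_ fun f => ⟨⟨?_, ?_⟩, ?_⟩
  · intro f g hfg
    ext ⟨q, hq⟩
    induction q using Quotient.inductionOn with
    | h x =>
      have := congrFun hfg x
      have hq' : G.IsInternalFace c (Quotient.mk _ x) := hq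
      rw [hL, hL, dif_pos hq', dif_pos hq'] at this
      exact this
  · exact fun h => hcongr f _ _ (Quotient.sound (Joined.symm (joined_left G.line (G.strand c) h)))
  · exact fun h => hcongr f _ _ (Quotient.sound (Joined.symm (joined_right G.line (G.strand c) h)))
  · intro h hh
    rw [hL, dif_neg]
    exact fun hint => hint h rfl hh

/-- The number of melonic vertices of colour `c`. -/
noncomputable def numMelonic (c : Fin 3) : ℕ := Nat.card {v // G.bubble v = .melonic c}

theorem card_add_numMelonic_le (c : Fin 3) :
    Fintype.card V + G.numMelonic c ≤ finrank (ZMod 2) (G.bubbleSpace c) := by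
  classical
  rw [numMelonic, Nat.card_eq_fintype_card, ← Fintype.card_sum]
  -- The bubble cycles are counted by one coordinate per vertex and one more for the half `{2, 3}`
  -- of each melonic vertex of colour `c`.
  let L : (V ⊕ {v // G.bubble v = .melonic c} → ZMod 2) →ₗ[ZMod 2] (V × Fin 4 → ZMod 2) :=
    { toFun := fun f h => f (.inl h.1) + if hh : G.bubble h.1 = .melonic c then
        (if h.2 = 2 ∨ h.2 = 3 then f (.inr ⟨h.1, hh⟩) else 0) else 0
      map_add' := fun f g => by
        ext h
        by_cases hh : G.bubble h.1 = .melonic c <;> by_cases h2 : h.2 = 2 ∨ h.2 = 3 <;>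
          (simp [hh, h2]; try ring)
      map_smul' := fun a f => by
        ext h
        by_cases hh : G.bubble h.1 = .melonic c <;> by_cases h2 : h.2 = 2 ∨ h.2 = 3 <;>
          (simp [hh, h2]; try ring) }
  have hL : ∀ f h, L f h = f (.inl h.1) + if hh : G.bubble h.1 = .melonic c then
      (if h.2 = 2 ∨ h.2 = 3 then f (.inr ⟨h.1, hh⟩) else 0) else 0 := fun f h => rfl
  have hinv : ∀ f d, d ≠ c → L f ∈ invariants (G.strand d) := by
    rintro f d hd ⟨v, i⟩
    rw [hL, hL]
    simp only [strand]
    by_cases hh : G.bubble v = .melonic c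
    · simp only [hh, Bubble.melonic_edge_eq_iff hd]
    · simp [hh]
  refine card_le_finrank_of_injective L ?_ fun f =>
    ⟨hinv f _ (by simp), hinv f _ (by simp)⟩
  intro f g hfg
  have h1 : ∀ v, f (.inl v) = g (.inl v) := fun v => by
    have := congrFun hfg (v, 0)
    simpa [hL] using this
  ext (v | ⟨v, hv⟩)
  · exact h1 v
  · have := congrFun hfg (v, 2)
    simpa [hL, hv, h1] using this

theorem finrank_ribbonSpace_le (hG : G.Connected) (c : Fin 3) :
    finrank (ZMod 2) (G.ribbonSpace c) ≤ G.numMelonic c + 1 := by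
  classical
  have h1 := (G.splitMap c).finrank_range_add_finrank_ker
  have h2 := G.finrank_ker_splitMap_le hG c
  have h3 := Submodule.finrank_le (LinearMap.range (G.splitMap c))
  rw [finrank_fintype_fun_eq_card] at h3
  rw [numMelonic, Nat.card_eq_fintype_card]
  omega

theorem splitMap_surjective (hG : G.Connected) (c : Fin 3)
    (h : G.numMelonic c < finrank (ZMod 2) (G.ribbonSpace c)) :
    Function.Surjective (G.splitMap c) := by
  classical
  have h1 := (G.splitMap c).finrank_range_add_finrank_ker
  have h2 := G.finrank_ker_splitMap_le hG c
  rw [numMelonic, Nat.card_eq_fintype_card] at h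
  rw [← LinearMap.range_eq_top]
  apply Submodule.eq_top_of_finrank_eq
  have h3 := Submodule.finrank_le (LinearMap.range (G.splitMap c))
  rw [finrank_fintype_fun_eq_card] at *
  omega

end Fintype

section Bounds

theorem numInternalFaces_eq :
    G.numInternalFaces = G.numInternal 0 + G.numInternal 1 + G.numInternal 2 := by
  rw [numInternalFaces, Fin.sum_univ_three]
  rfl

variable [Fintype V]

/-! ### Bounds on the number of internal faces -/

/-- A line fixes the legs, so the two face spaces are orthogonal only if one of them vanishes there.
Hence the asymmetry: all faces of one colour, but only internal faces of the other. -/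
theorem euler_leg (c : Fin 3) (e : G.ExternalLeg) :
    2 * (Fintype.card V + G.numMelonic c + Nat.card (G.Face (c + 1)) + G.numInternal (c + 2)) + 2 ≤
      4 * Fintype.card V + 4 * finrank (ZMod 2) (G.ribbonSpace c) := by
  have key := euler_inequality (G.strand_involutive (c + 1)) (G.strand_ne _)
    (P := G.bubbleSpace c) (Q := G.faceSpace (c + 1)) (R := G.faceSpace (c + 2) ⊓ G.legVanishing)
    inf_le_left inf_le_right
    (fun f hf g hg => sum_eq_zero_of_invariant (G.strand_involutive (c + 2))
      (fun h => by rw [hf.2 h, hg.1.2 h]) fun h hh => absurd hh (G.strand_ne _ h))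
    (fun f hf g hg => sum_eq_zero_of_invariant G.line_involutive
      (fun h => by rw [hf.1 h, hg.1.1 h]) fun h hh => by rw [hg.2 h hh, mul_zero])
  have h1 : finrank (ZMod 2) (G.bubbleSpace c ⊓ G.faceSpace (c + 1) : Submodule (ZMod 2) _) ≤
      finrank (ZMod 2) (G.ribbonSpace c) :=
    Submodule.finrank_mono fun f hf => ⟨hf.1, hf.2.1⟩
  -- Strict because the constant `1` does not vanish at the leg `e`; this gains the summand `2` in
  -- the conclusion.
  have h2 : finrank (ZMod 2) ((G.faceSpace (c + 2) ⊓ G.legVanishing) ⊓ invariants (G.strand (c + 1)) :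
      Submodule (ZMod 2) _) < finrank (ZMod 2) (G.ribbonSpace c) := by
    refine Submodule.finrank_lt_finrank_of_lt (lt_of_le_of_ne
      (fun f hf => ⟨⟨hf.2, hf.1.1.2⟩, hf.1.1.1⟩) fun heq => ?_)
    have hone : (fun _ => 1 : V × Fin 4 → ZMod 2) ∈ G.ribbonSpace c :=
      ⟨⟨fun _ => rfl, fun _ => rfl⟩, fun _ => rfl⟩
    rw [← heq] at hone
    exact one_ne_zero (hone.1.2 e.1 e.2)
  have h3 := G.card_face_le (c + 1)
  have h4 := G.numInternal_le (c + 2)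
  have h5 := G.card_add_numMelonic_le c
  have h6 : Fintype.card (V × Fin 4) = 4 * Fintype.card V := by
    rw [Fintype.card_prod, Fintype.card_fin, mul_comm]
  omega

/-- A stronger bound when all colours pair the external legs in the same way. -/
theorem euler_of_partner_eq (hp : ∀ c e, G.partner c e = G.partner 0 e) (c : Fin 3) :
    2 * (Fintype.card V + G.numMelonic c + Nat.card (G.Face (c + 1)) + Nat.card (G.Face (c + 2))) ≤
      4 * Fintype.card V + 4 * finrank (ZMod 2) (G.ribbonSpace c) := by
  classical
  -- `τ` glues the legs along the common matching. It has no fixed point and preserves the faces of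
  -- every colour, so no vanishing condition on the legs is needed.
  let τ : V × Fin 4 → V × Fin 4 := fun h =>
    if hh : G.line h = h then (G.partner 0 ⟨h, hh⟩).1 else G.line h
  have τleg : ∀ h (hh : G.line h = h), τ h = (G.partner 0 ⟨h, hh⟩).1 := fun h hh => dif_pos hh
  have τline : ∀ h, G.line h ≠ h → τ h = G.line h := fun h hh => dif_neg hh
  have hτ : Function.Involutive τ := by
    intro h
    by_cases hh : G.line h = h
    · rw [τleg h hh, τleg _ (G.partner 0 ⟨h, hh⟩).2, G.partner_involutive 0 ⟨h, hh⟩]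
    · rw [τline h hh, τline _ (by rw [G.line_line]; exact Ne.symm hh), G.line_line]
  have τne : ∀ h, τ h ≠ h := by
    intro h
    by_cases hh : G.line h = h
    · rw [τleg h hh]
      exact fun heq => G.partner_ne 0 ⟨h, hh⟩ (Subtype.ext heq)
    · rw [τline h hh]; exact hh
  have τinv : ∀ d, ∀ f ∈ G.faceSpace d, ∀ h, f (τ h) = f h := by
    intro d f hf h
    by_cases hh : G.line h = h
    · rw [τleg h hh, ← hp d, G.apply_partner hf.1 hf.2]
    · rw [τline h hh, hf.1]
  have key := euler_inequality (G.strand_involutive (c + 1)) (G.strand_ne _)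
    (P := G.bubbleSpace c) (Q := G.faceSpace (c + 1)) (R := G.faceSpace (c + 2))
    inf_le_left inf_le_right
    (fun f hf g hg => sum_eq_zero_of_invariant (G.strand_involutive (c + 2))
      (fun h => by rw [hf.2 h, hg.2 h]) fun h hh => absurd hh (G.strand_ne _ h))
    (fun f hf g hg => sum_eq_zero_of_invariant hτ
      (fun h => by rw [τinv _ f hf h, τinv _ g hg h]) fun h hh => absurd hh (τne h))
  have h1 : finrank (ZMod 2) (G.bubbleSpace c ⊓ G.faceSpace (c + 1) : Submodule (ZMod 2) _) ≤
      finrank (ZMod 2) (G.ribbonSpace c) :=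
    Submodule.finrank_mono fun f hf => ⟨hf.1, hf.2.1⟩
  have h2 : finrank (ZMod 2) (G.faceSpace (c + 2) ⊓ invariants (G.strand (c + 1)) :
      Submodule (ZMod 2) _) ≤ finrank (ZMod 2) (G.ribbonSpace c) :=
    Submodule.finrank_mono fun f hf => ⟨⟨hf.2, hf.1.2⟩, hf.1.1⟩
  have h3 := G.card_face_le (c + 1)
  have h4 := G.card_face_le (c + 2)
  have h5 := G.card_add_numMelonic_le c
  have h6 : Fintype.card (V × Fin 4) = 4 * Fintype.card V := by
    rw [Fintype.card_prod, Fintype.card_fin, mul_comm]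
  omega

/-- The number of tetrahedral vertices. -/
noncomputable def numTetra : ℕ := Nat.card {v // G.bubble v = .tetra}

theorem card_eq_numTetra_add : Fintype.card V =
    G.numTetra + (G.numMelonic 0 + G.numMelonic 1 + G.numMelonic 2) := by
  classical
  let κ : V → Option (Fin 3) := fun v =>
    match G.bubble v with
    | .tetra => none
    | .melonic c => some c
  have hκ : ∀ v, (κ v = none ↔ G.bubble v = .tetra) ∧
      ∀ c, κ v = some c ↔ G.bubble v = .melonic c := by
    intro v
    simp only [κ]
    cases G.bubble v <;> simp
  rw [← Finset.card_univ, Finset.card_eq_sum_card_fiberwise (f := κ) (t := Finset.univ)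
    (fun _ _ => Finset.mem_coe.2 (Finset.mem_univ _)), Fintype.sum_option, Fin.sum_univ_three]
  simp only [numTetra, numMelonic, Nat.card_eq_fintype_card, Fintype.card_subtype,
    (hκ _).1, (hκ _).2]

/-- In the cyclic sum of `euler_leg`, each colour occurs once with all its faces and once with only
its internal ones. The ranks are kept because the case of equality needs them. -/
theorem face_bound_finrank (hN : 0 < G.numExt) :
    4 * G.numInternalFaces + 3 * G.numExt +
        2 * (G.numMelonic 0 + G.numMelonic 1 + G.numMelonic 2) + 6 ≤
      6 * Fintype.card V + 4 * (finrank (ZMod 2) (G.ribbonSpace 0) +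
        finrank (ZMod 2) (G.ribbonSpace 1) + finrank (ZMod 2) (G.ribbonSpace 2)) := by
  obtain ⟨⟨e⟩, -⟩ := Nat.card_pos_iff.1 hN
  have h0 := G.euler_leg 0 e
  have h1 := G.euler_leg 1 e
  have h2 := G.euler_leg 2 e
  have f0 := G.numExt_le 0
  have f1 := G.numExt_le 1
  have f2 := G.numExt_le 2
  rw [G.numInternalFaces_eq]
  change 2 * (_ + _ + Nat.card (G.Face 1) + G.numInternal 2) + 2 ≤ _ at h0
  change 2 * (_ + _ + Nat.card (G.Face 2) + G.numInternal 0) + 2 ≤ _ at h1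
  change 2 * (_ + _ + Nat.card (G.Face 0) + G.numInternal 1) + 2 ≤ _ at h2
  omega

theorem face_bound (hG : G.Connected) (hN : 0 < G.numExt) :
    4 * G.numInternalFaces + 3 * G.numExt + 2 * G.numTetra ≤ 8 * Fintype.card V + 6 := by
  have := G.face_bound_finrank hN
  have := G.card_eq_numTetra_add
  have := G.finrank_ribbonSpace_le hG 0
  have := G.finrank_ribbonSpace_le hG 1
  have := G.finrank_ribbonSpace_le hG 2
  omega

theorem face_bound_of_partner_eq (hG : G.Connected)
    (hp : ∀ c e, G.partner c e = G.partner 0 e) :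
    4 * G.numInternalFaces + 6 * G.numExt ≤ 8 * Fintype.card V + 12 := by
  have h0 := G.euler_of_partner_eq hp 0
  have h1 := G.euler_of_partner_eq hp 1
  have h2 := G.euler_of_partner_eq hp 2
  have f0 := G.numExt_le 0
  have f1 := G.numExt_le 1
  have f2 := G.numExt_le 2
  rw [G.numInternalFaces_eq]
  change 2 * (_ + _ + Nat.card (G.Face 1) + Nat.card (G.Face 2)) ≤ _ at h0
  change 2 * (_ + _ + Nat.card (G.Face 2) + Nat.card (G.Face 0)) ≤ _ at h1
  change 2 * (_ + _ + Nat.card (G.Face 0) + Nat.card (G.Face 1)) ≤ _ at h2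
  have := G.card_eq_numTetra_add
  have := G.finrank_ribbonSpace_le hG 0
  have := G.finrank_ribbonSpace_le hG 1
  have := G.finrank_ribbonSpace_le hG 2
  omega

end Bounds

end FeynmanGraph

/-- The three perfect matchings of four fields are the edges of the tetrahedral bubble. -/
theorem exists_tetra_edge (μ : Fin 4 → Fin 4) (h1 : ∀ i, μ (μ i) = i) (h2 : ∀ i, μ i ≠ i) :
    ∃ k, ∀ i, μ i = Bubble.tetra.edge k i := by
  revert μ
  set_option maxRecDepth 100000 in decide

/-- Three matchings of four fields agree or form a bubble. -/
theorem exists_perm_edge (k : Fin 3 → Fin 3) (hk : ¬ ∀ c, k c = k 0) :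
    ∃ (b : Bubble) (φ : Equiv.Perm (Fin 4)),
      (b = .tetra ∨ ∃ c, b = .melonic c) ∧
      ∀ c i, φ (Bubble.tetra.edge (k c) i) = b.edge c (φ i) := by
  have h : ∀ k : Fin 3 → Fin 3, (∀ c, k c = k 0) ∨
      (∃ φ : Equiv.Perm (Fin 4), ∀ c i, φ (Bubble.tetra.edge (k c) i) = Bubble.tetra.edge c (φ i)) ∨
      ∃ (d : Fin 3) (φ : Equiv.Perm (Fin 4)),
        ∀ c i, φ (Bubble.tetra.edge (k c) i) = (Bubble.melonic d).edge c (φ i) := by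
    set_option maxRecDepth 100000 in decide
  rcases h k with h | ⟨φ, h⟩ | ⟨d, φ, h⟩
  · exact absurd h hk
  · exact ⟨_, φ, Or.inl rfl, h⟩
  · exact ⟨_, φ, Or.inr ⟨d, rfl⟩, h⟩

/-- Any two colours of the tetrahedral bubble connect all of its fields. -/
theorem Bubble.tetra_connected (c : Fin 3) (i j : Fin 4) :
    j = i ∨ j = Bubble.tetra.edge (c + 1) i ∨ j = Bubble.tetra.edge (c + 2) i ∨
      j = Bubble.tetra.edge (c + 1) (Bubble.tetra.edge (c + 2) i) := by
  revert c i j; decide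

theorem Bubble.reachable (b : Bubble) (i j : Fin 4) :
    j = i ∨ (∃ c, b.edge c i = j) ∨ ∃ c c', b.edge c (b.edge c' i) = j := by
  rcases b with _ | d
  · revert i j; decide
  · revert d i j; decide

namespace FeynmanGraph

variable {V : Type*} (G : FeynmanGraph V)

/-! ### The boundary graph of a four-point graph -/

theorem boundaryIs_iff [Finite V] {b : Bubble} : G.BoundaryIs b ↔
    ∃ φ : G.ExternalLeg ≃ Fin 4, ∀ c e, φ (G.partner c e) = b.edge c (φ e) := by
  refine exists_congr fun φ => ⟨fun h c e => ((h c e _).1 (G.boundaryAdj_partner c e)).symm, ?_⟩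
  intro h c e e'
  rw [G.boundaryAdj_iff, ← h, φ.apply_eq_iff_eq]

variable {G} in
theorem BoundaryIs.connected [Finite V] {b : Bubble} (hb : G.BoundaryIs b) :
    G.boundaryGraph.Connected := by
  obtain ⟨φ, h⟩ := G.boundaryIs_iff.1 hb
  have adj : ∀ c e, G.boundaryGraph.Adj e (G.partner c e) := fun c e =>
    ⟨c, G.boundaryAdj_partner c e⟩
  have : Nonempty G.ExternalLeg := ⟨φ.symm 0⟩
  refine SimpleGraph.Connected.mk fun e e' => ?_
  rcases b.reachable (φ e) (φ e') with h1 | ⟨c, h1⟩ | ⟨c, c', h1⟩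
  · rw [φ.injective h1]
  · rw [← h, φ.apply_eq_iff_eq] at h1
    exact h1 ▸ (adj c e).reachable
  · rw [← h, ← h, φ.apply_eq_iff_eq] at h1
    exact h1 ▸ (adj c' e).reachable.trans (adj c _).reachable

theorem exists_boundaryIs [Finite V] (hN : G.numExt = 4)
    (hp : ¬ ∀ c e, G.partner c e = G.partner 0 e) :
    ∃ b, (b = .tetra ∨ ∃ c, b = .melonic c) ∧ G.BoundaryIs b := by
  have : Finite G.ExternalLeg := Subtype.finite
  let ψ : G.ExternalLeg ≃ Fin 4 := Finite.equivFinOfCardEq hN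
  have hk : ∀ c, ∃ k, ∀ i, ψ (G.partner c (ψ.symm i)) = Bubble.tetra.edge k i := fun c =>
    exists_tetra_edge _ (fun i => by simp [G.partner_involutive c _]) fun i h =>
      G.partner_ne c (ψ.symm i) (by rw [← ψ.symm_apply_apply (G.partner _ _), h])
  choose k hk using hk
  obtain ⟨b, φ, hb, hφ⟩ := exists_perm_edge k fun hc => hp fun c e => ψ.injective (by
    have h1 := hk c (ψ e)
    have h2 := hk 0 (ψ e)
    rw [ψ.symm_apply_apply] at h1 h2
    rw [h1, h2, hc c])
  refine ⟨b, hb, G.boundaryIs_iff.2 ⟨ψ.trans φ, fun c e => ?_⟩⟩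
  have h1 := hk c (ψ e)
  rw [ψ.symm_apply_apply] at h1
  simp only [Equiv.trans_apply, h1, hφ]

/-! ### Dressed tetrahedral vertices -/

/-- The half-line of the same melonic vertex that lies on the same side; the half-lines of
tetrahedral vertices are fixed. -/
def chain (h : V × Fin 4) : V × Fin 4 :=
  match G.bubble h.1 with
  | .tetra => h
  | .melonic _ => (h.1, ![1, 0, 3, 2] h.2)

theorem chain_tetra {v : V} (hv : G.bubble v = .tetra) (i : Fin 4) :
    G.chain (v, i) = (v, i) := by simp [chain, hv]

theorem chain_melonic {v : V} {c : Fin 3} (hv : G.bubble v = .melonic c) (i : Fin 4) :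
    G.chain (v, i) = (v, ![1, 0, 3, 2] i) := by simp [chain, hv]

theorem chain_involutive : Function.Involutive G.chain := by
  rintro ⟨v, i⟩
  rcases hv : G.bubble v with _ | c
  · rw [G.chain_tetra hv, G.chain_tetra hv]
  · rw [G.chain_melonic hv, G.chain_melonic hv]
    congr 1
    revert i; decide

theorem tetra_of_chain_eq {v : V} {i : Fin 4} (h : G.chain (v, i) = (v, i)) :
    G.bubble v = .tetra := by
  rcases hv : G.bubble v with _ | c
  · rfl
  · rw [G.chain_melonic hv] at h
    have key : ∀ i : Fin 4, ![1, 0, 3, 2] i ≠ i := by decide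
    exact absurd (congrArg Prod.snd h) (key i)

/-- A melonic vertex separates the graph without separating external legs. -/
structure IsSeparator (v : V) (f : V × Fin 4 → ZMod 2) : Prop where
  line : ∀ h, f (G.line h) = f h
  leg : ∀ h, G.line h = h → f h = 0
  const : ∀ w i, w ≠ v → f (w, i) = f (w, 0)
  jump : ∀ c, G.bubble v = .melonic c →
    ∀ i, f (v, i) = f (v, 0) + if i = 2 ∨ i = 3 then 1 else 0
  tetra : G.bubble v = .tetra → ∀ i, f (v, i) = f (v, 0)

theorem exists_isSeparator [Fintype V] (hb : G.BoundaryIs .tetra)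
    (hs : ∀ c, Function.Surjective (G.splitMap c)) (v : V) : ∃ f, G.IsSeparator v f := by
  classical
  rcases hv : G.bubble v with _ | c
  · exact ⟨0, fun _ => rfl, fun _ _ => rfl, fun _ _ _ => rfl, fun c h => by simp [hv] at h,
      fun _ _ => rfl⟩
  obtain ⟨⟨f, hf⟩, hfv⟩ := hs c (Pi.single ⟨v, hv⟩ 1)
  have hjump : ∀ w (hw : G.bubble w = .melonic c),
      f (w, 0) + f (w, 2) = if w = v then 1 else 0 := fun w hw => by
    have := congrFun hfv ⟨w, hw⟩
    rw [Pi.single_apply] at this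
    simpa [splitMap] using this
  obtain ⟨φ, hφ⟩ := G.boundaryIs_iff.1 hb
  -- Any two colours of a tetrahedral boundary connect all legs, so a shift by a constant makes `f`
  -- vanish on them.
  have hleg : ∀ e e' : G.ExternalLeg, f e'.1 = f e.1 := by
    intro e e'
    have p1 := G.apply_partner hf.2 hf.1.1
    have p2 := G.apply_partner hf.2 hf.1.2
    rcases Bubble.tetra_connected c (φ e) (φ e') with h | h | h | h
    · rw [φ.injective h]
    · rw [← hφ, φ.apply_eq_iff_eq] at h
      rw [h, p1]
    · rw [← hφ, φ.apply_eq_iff_eq] at h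
      rw [h, p2]
    · rw [← hφ, ← hφ, φ.apply_eq_iff_eq] at h
      rw [h, p1, p2]
  let e := φ.symm 0
  refine ⟨fun h => f h + f e.1, fun h => by rw [hf.2 h], fun h hh => ?_, fun w i hw => ?_,
    fun c' _ i => ?_, fun h => by simp [hv] at h⟩
  · rw [hleg e ⟨h, hh⟩]
    exact CharTwo.add_self_eq_zero _
  · rw [G.vertexConst_of_mem_bubbleSpace hf.1 w fun hw' => by
      have := hjump w hw'
      rw [if_neg hw] at this
      exact CharTwo.add_eq_zero.1 this]
  · have h2 : f (v, 2) = f (v, 0) + 1 := by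
      have := hjump v hv
      rw [if_pos rfl] at this
      rw [← this, ← add_assoc, CharTwo.add_self_eq_zero, zero_add]
    have hst := fun i => hf.1.1 (v, i)
    simp only [strand, hv] at hst
    have e1 : ∀ c : Fin 3, (Bubble.melonic c).edge (c + 1) 0 = 1 ∧
      (Bubble.melonic c).edge (c + 1) 2 = 3 := by decide
    have h1 := hst 0
    have h3 := hst 2
    rw [(e1 c).1] at h1
    rw [(e1 c).2] at h3
    have hi : i = 0 ∨ i = 1 ∨ i = 2 ∨ i = 3 := by revert i; decide
    rcases hi with rfl | rfl | rfl | rfl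
    · simp
    · simp [h1]
    · simp [h2]; ring
    · simp [h3, h2]; ring

/-- A function that is constant along chains can be made constant on the melonic vertices, without
changing its values on the external legs and its jumps along lines and at tetrahedral vertices. -/
theorem exists_straighten [Fintype V] (hs : ∀ v, ∃ f, G.IsSeparator v f)
    (g : V × Fin 4 → ZMod 2) (hg : ∀ h, g (G.chain h) = g h) :
    ∃ h : V × Fin 4 → ZMod 2,
      (∀ x, h (G.line x) + h x = g (G.line x) + g x) ∧ (∀ x, G.line x = x → h x = g x) ∧
      (∀ v c i, G.bubble v = .melonic c → h (v, i) = h (v, 0)) ∧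
      ∀ v i, G.bubble v = .tetra → h (v, i) + h (v, 0) = g (v, i) + g (v, 0) := by
  classical
  choose f hf using hs
  -- The coefficient is the jump of `g` between the halves of `w`. For melonic `w`, `f w` has a unit
  -- jump there and none at other vertices, so `S` cancels exactly these jumps.
  let S : V × Fin 4 → ZMod 2 := fun x => ∑ w, (g (w, 0) + g (w, 2)) * f w x
  have hS : ∀ v i, S (v, i) + S (v, 0) =
      (g (v, 0) + g (v, 2)) * (f v (v, i) + f v (v, 0)) := by
    intro v i
    simp only [S]
    rw [← Finset.sum_add_distrib, Finset.sum_eq_single v]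
    · ring
    · intro w _ hw
      rw [(hf w).const v i hw.symm]
      exact CharTwo.add_self_eq_zero _
    · simp
  have hline : ∀ x, S (G.line x) = S x := fun x => by simp only [S, (hf _).line]
  have hleg : ∀ x, G.line x = x → S x = 0 := fun x hx => by simp [S, (hf _).leg x hx]
  clear_value S
  refine ⟨fun x => g x + S x, fun x => ?_, fun x hx => ?_, fun v c i hv => ?_, fun v i hv => ?_⟩
  · simp only [hline]
    linear_combination CharTwo.add_self_eq_zero (S x)
  · simp only [hleg x hx, add_zero]
  · have h1 := hS v i
    rw [(hf v).jump c hv] at h1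
    have h01 := hg (v, 0)
    have h23 := hg (v, 2)
    rw [G.chain_melonic hv] at h01 h23
    simp only [Matrix.cons_val] at h01 h23
    have h0 := CharTwo.add_self_eq_zero (f v (v, 0))
    have hS0 := CharTwo.add_self_eq_zero (S (v, 0))
    have hg2 := CharTwo.add_self_eq_zero (g (v, 2))
    have hi : i = 0 ∨ i = 1 ∨ i = 2 ∨ i = 3 := by clear * -; revert i; decide
    have hJ : i = 2 ∨ i = 3 → g (v, i) = g (v, 2) := by
      rintro (rfl | rfl)
      · rfl
      · exact h23
    by_cases hi2 : i = 2 ∨ i = 3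
    · rw [if_pos hi2] at h1
      simp only [hJ hi2]
      linear_combination h1 + (g (v, 0) + g (v, 2)) * h0 - hS0 + hg2
    · rw [if_neg hi2] at h1
      have : g (v, i) = g (v, 0) := by
        rcases hi with rfl | rfl | rfl | rfl
        · rfl
        · exact h01
        · simp at hi2
        · simp at hi2
      simp only [this]
      linear_combination h1 + (g (v, 0) + g (v, 2)) * h0 - hS0
  · have h1 := hS v i
    rw [(hf v).tetra hv i, CharTwo.add_self_eq_zero, mul_zero] at h1
    linear_combination h1

/-- If the chain avoided the tetrahedral vertices, straightening its indicator would give a function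
constant on lines and vertices, yet different at legs on and off the chain. -/
theorem exists_chain_end [Fintype V] (hG : G.Connected) (hN : G.numExt = 4)
    (hs : ∀ v, ∃ f, G.IsSeparator v f) (e : G.ExternalLeg) :
    ∃ d, G.chain d = d ∧ Joined G.line G.chain e.1 d := by
  classical
  by_contra! hno
  -- A chain ends in at most two legs, and there are four.
  obtain ⟨e', he'⟩ : ∃ e' : G.ExternalLeg, ¬ Joined G.line G.chain e.1 e'.1 := by
    by_contra! hall
    rw [numExt, Nat.card_eq_fintype_card, ← Finset.card_univ] at hN
    obtain ⟨a, b, c, -, -, -, hab, hac, hbc⟩ := Finset.two_lt_card_iff.1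
      (show 2 < (Finset.univ : Finset G.ExternalLeg).card by omega)
    rcases eq_or_eq_of_joined G.line_involutive G.chain_involutive a.2 b.2 c.2
      ((hall a).symm.trans (hall b)) ((hall a).symm.trans (hall c)) with h | h | h
    · exact hab (Subtype.ext h).symm
    · exact hac (Subtype.ext h).symm
    · exact hbc (Subtype.ext h)
  let g : V × Fin 4 → ZMod 2 := fun x => if Joined G.line G.chain e.1 x then 1 else 0
  have gcongr : ∀ x y, Joined G.line G.chain x y → g x = g y := fun x y hxy =>
    if_congr ⟨fun h => h.trans hxy, fun h => h.trans hxy.symm⟩ rfl rfl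
  obtain ⟨h, hl, hleg, hmel, htet⟩ := G.exists_straighten hs g
    fun x => (gcongr _ _ (joined_right G.line G.chain x)).symm
  have hconst := hG.eq_of_invariant (f := h) G
    (fun x => by
      have := hl x
      rw [← gcongr _ _ (joined_left G.line G.chain x), CharTwo.add_self_eq_zero] at this
      exact CharTwo.add_eq_zero.1 this)
    (fun v i => by
      rcases hv : G.bubble v with _ | c
      · have hg0 : ∀ j, g (v, j) = 0 := fun j => if_neg (hno _ (G.chain_tetra hv j))
        have := htet v i hv
        rw [hg0, hg0, add_zero] at this
        exact CharTwo.add_eq_zero.1 this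
      · exact hmel v c i hv) e.1 e'.1
  rw [hleg _ e.2, hleg _ e'.2] at hconst
  simp only [g, if_neg he', if_pos (Relation.EqvGen.refl e.1 : Joined _ _ _ _)] at hconst
  exact one_ne_zero hconst

theorem isBridge_of_chain_end [Fintype V] (hs : ∀ v, ∃ f, G.IsSeparator v f) {v : V} (i : Fin 4)
    (hv : G.bubble v = .tetra) (huniq : ∀ w, G.bubble w = .tetra → w = v)
    (e : G.ExternalLeg) (he : Joined G.line G.chain e.1 (v, i)) (hne : G.line (v, i) ≠ (v, i)) :
    G.IsBridge (v, i) := by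
  classical
  refine ⟨hne, fun hcut => ?_⟩
  -- Removing the end `(v, i)` from the indicator of its chain leaves a jump along the line at `(v,
  -- i)` only. Straightening preserves it, so the cut graph carries a nonconstant function that is
  -- constant on lines and vertices.
  let g : V × Fin 4 → ZMod 2 := fun x =>
    if Joined G.line G.chain (v, i) x ∧ x ≠ (v, i) then 1 else 0
  have jcongr : ∀ {x y}, Joined G.line G.chain x y →
      (Joined G.line G.chain (v, i) x ↔ Joined G.line G.chain (v, i) y) := fun hxy =>
    ⟨fun h => h.trans hxy, fun h => h.trans hxy.symm⟩
  have hfix := G.chain_tetra hv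
  have gchain : ∀ x, g (G.chain x) = g x := fun x =>
    if_congr (and_congr (jcongr (joined_right G.line G.chain x)).symm
      (not_congr ⟨fun h => by rw [← G.chain_involutive x, h, hfix], fun h => by rw [h, hfix]⟩))
      rfl rfl
  have gline : ∀ x, x ≠ (v, i) → x ≠ G.line (v, i) → g (G.line x) = g x := fun x h1 h2 =>
    if_congr (and_congr (jcongr (joined_left G.line G.chain x)).symm
      ⟨fun _ => h1, fun _ h => h2 (by rw [← h, G.line_line])⟩) rfl rfl
  -- The other end of this chain is the leg `e`, so it meets no further half-line of the tetrahedral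
  -- vertex.
  have gzero : ∀ j, g (v, j) = 0 := fun j => if_neg fun ⟨hj, hne'⟩ =>
    hne' (eq_of_joined_of_fixed G.chain_involutive G.line_involutive (hfix i) (hfix j) e.2
      hj.swap he.symm.swap)
  have gone : g (G.line (v, i)) = 1 := if_pos ⟨joined_left _ _ _, hne⟩
  obtain ⟨h, hl, -, hmel, htet⟩ := G.exists_straighten hs g gchain
  have hconst := hcut.eq_of_invariant (f := h) (G.cut (v, i))
    (fun x => by
      by_cases hx : x = (v, i) ∨ x = G.line (v, i)
      · simp only [cut, if_pos hx]
      · simp only [cut, if_neg hx]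
        obtain ⟨h1, h2⟩ := not_or.1 hx
        have := hl x
        rw [gline x h1 h2, CharTwo.add_self_eq_zero] at this
        exact CharTwo.add_eq_zero.1 this)
    (fun w j => by
      rcases hw : G.bubble w with _ | c
      · obtain rfl := huniq w hw
        have := htet w j hw
        rw [gzero, gzero, add_zero] at this
        exact CharTwo.add_eq_zero.1 this
      · exact hmel w c j hw) (G.line (v, i)) (v, i)
  have := hl (v, i)
  rw [hconst, CharTwo.add_self_eq_zero, gone, gzero] at this
  simp at this

theorem isDressedTetra_of_surjective [Fintype V] (hG : G.Connected) (hN : G.numExt = 4)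
    (hb : G.BoundaryIs .tetra) (hs : ∀ c, Function.Surjective (G.splitMap c))
    (ht : G.numTetra ≤ 1) : G.IsDressedTetra := by
  classical
  have hsep := G.exists_isSeparator hb hs
  choose d hd hj using G.exists_chain_end hG hN hsep
  have htetra : ∀ e, G.bubble (d e).1 = .tetra := fun e => G.tetra_of_chain_eq (hd e)
  obtain ⟨φ, -⟩ := hb
  have huniq : ∀ w w', G.bubble w = .tetra → G.bubble w' = .tetra → w = w' := by
    intro w w' hw hw'
    rw [numTetra, Nat.card_eq_fintype_card] at ht
    exact congrArg Subtype.val (Fintype.card_le_one_iff.1 ht ⟨w, hw⟩ ⟨w', hw'⟩)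
  let v := (d (φ.symm 0)).1
  have hv : G.bubble v = .tetra := htetra _
  have hdv : ∀ e, d e = (v, (d e).2) := fun e => Prod.ext (huniq _ _ (htetra e) hv) rfl
  -- A chain ending at the tetrahedral vertex contains only one leg, so the four chains exhaust its
  -- four half-lines.
  have hinj : Function.Injective fun e => (d e).2 := by
    intro e e' hee
    have : d e = d e' := by rw [hdv e, hdv e']; exact congrArg _ hee
    exact (Subtype.ext (eq_of_joined_of_fixed G.line_involutive G.chain_involutive e.2 e'.2 (hd e)
      ((hj e).trans (this ▸ (hj e').symm)) (hj e))).symm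
  have hsurj : Function.Surjective fun e => (d e).2 :=
    ((Fintype.bijective_iff_injective_and_card _).2 ⟨hinj, Fintype.card_congr φ⟩).2
  refine ⟨v, hv, fun w hw => huniq w v hw hv, fun i => ?_⟩
  by_cases hline : G.line (v, i) = (v, i)
  · exact Or.inl hline
  · obtain ⟨e, rfl⟩ := hsurj i
    have he := hj e
    rw [hdv e] at he
    exact Or.inr (G.isBridge_of_chain_end hsep _ hv (fun w hw => huniq w v hw hv) e he hline)

theorem face_bound_of_boundaryIs_tetra [Fintype V] (hG : G.Connected) (hN : G.numExt = 4)
    (hb : G.BoundaryIs .tetra) (hd : ¬ G.IsDressedTetra) :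
    G.numInternalFaces + 3 ≤ 2 * Fintype.card V := by
  by_contra! hlt
  -- Let `M` be the sum of the `m_c` and `R` the sum of the ribbon ranks. With `F ≥ 2V - 2` this
  -- reads `2T + 4M + 10 ≤ 4R`, while `4R ≤ 4M + 12`. Hence `T ≤ 1` and, by integrality, every rank
  -- is maximal.
  have h0 := G.face_bound_finrank (by omega)
  have hV := G.card_eq_numTetra_add
  have r0 := G.finrank_ribbonSpace_le hG 0
  have r1 := G.finrank_ribbonSpace_le hG 1
  have r2 := G.finrank_ribbonSpace_le hG 2
  refine hd (G.isDressedTetra_of_surjective hG hN hb (fun c => G.splitMap_surjective hG c ?_)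
    (by omega))
  have hc : c = 0 ∨ c = 1 ∨ c = 2 := by revert c; decide
  rcases hc with rfl | rfl | rfl <;> omega

end FeynmanGraph

end TensorSYK

/-! ### Power counting -/

theorem mainTheorem4 {V : Type*} [Fintype V] (G : TensorSYK.FeynmanGraph V)
    (hG : G.Connected) :
    (6 ≤ G.numExt →
      G.divergenceDegree ≤ -(G.numExt : ℚ) / 12 ∧ G.divergenceDegree < 0) ∧
    (G.numExt = 4 →
      G.divergenceDegree ≤ 0 ∧
      (G.divergenceDegree = 0 → ¬ G.IsDressedTetra →
        ∃ c : Fin 3, G.BoundaryIs (.melonic c)) ∧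
      (G.BoundaryIs .tetra → ¬ G.IsDressedTetra → G.divergenceDegree ≤ -(1 / 2)) ∧
      (¬ G.boundaryGraph.Connected → G.divergenceDegree ≤ -(1 / 2))) ∧
    (G.numExt = 2 → G.divergenceDegree ≤ 1) := by
  have bound := G.face_bound hG
  have small : G.numInternalFaces + 3 ≤ 2 * Fintype.card V →
      G.divergenceDegree ≤ -(1 / 2) := by
    intro h
    have : (G.numInternalFaces : ℚ) + 3 ≤ 2 * Fintype.card V := by exact_mod_cast h
    rw [TensorSYK.FeynmanGraph.divergenceDegree]
    linarith
  have aligned : G.numExt = 4 → (∀ c e, G.partner c e = G.partner 0 e) →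
      G.divergenceDegree ≤ -(1 / 2) := fun hN hp =>
    small (by have := G.face_bound_of_partner_eq hG hp; omega)
  refine ⟨fun hN => ?_, fun hN => ⟨?_, fun h0 hd => ?_, fun hb hd => ?_, fun hc => ?_⟩,
    fun hN => ?_⟩
  -- The degree is at most `(14 - 3N)/8`, which is at most `-N/12` exactly when `N ≥ 6`.
  · have h1 := bound (by omega)
    have h2 : 4 * (G.numInternalFaces : ℚ) + 3 * G.numExt ≤ 8 * Fintype.card V + 6 := by
      exact_mod_cast (Nat.le_add_right _ _).trans h1
    have h3 : (6 : ℚ) ≤ G.numExt := by exact_mod_cast hN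
    rw [TensorSYK.FeynmanGraph.divergenceDegree]
    constructor <;> linarith
  -- The bound `4F ≤ 8V - 6` improves to `F ≤ 2V - 2` by integrality.
  · have h1 : G.numInternalFaces + 2 ≤ 2 * Fintype.card V := by
      have := bound (by omega)
      omega
    have h2 : (G.numInternalFaces : ℚ) + 2 ≤ 2 * Fintype.card V := by exact_mod_cast h1
    rw [TensorSYK.FeynmanGraph.divergenceDegree]
    linarith
  · obtain ⟨b, rfl | ⟨c, rfl⟩, hb⟩ := G.exists_boundaryIs hN fun hp => by
      have := aligned hN hp
      rw [h0] at this
      norm_num at this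
    · have := small (G.face_bound_of_boundaryIs_tetra hG hN hb hd)
      rw [h0] at this
      norm_num at this
    · exact ⟨c, hb⟩
  · exact small (G.face_bound_of_boundaryIs_tetra hG hN hb hd)
  · refine aligned hN (by_contra fun hp => ?_)
    obtain ⟨b, -, hb⟩ := G.exists_boundaryIs hN hp
    exact hc hb.connected
  · have h1 : G.numInternalFaces ≤ 2 * Fintype.card V := by
      have := bound (by omega)
      omega
    have h2 : (G.numInternalFaces : ℚ) ≤ 2 * Fintype.card V := by exact_mod_cast h1
    rw [TensorSYK.FeynmanGraph.divergenceDegree]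
    linarith
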